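/- Let $\mathcal Y$ be a finite nonempty set, $d\ge 1$, and $\phi:\mathcal Y\to\{0,1\}^d$. For $\theta\in\mathbb R^d$ let $p_\theta(y)=\exp\{\phi(y)^\top\theta-A(\theta)\}$ with $A(\theta)=\log\sum_{y\in\mathcal Y}\exp\{\phi(y)^\top\theta\}$. Fix $\theta^*\in\mathbb R^d$ and assume that the Fisher information matrix $\mathcal I=\operatorname{Cov}_{y\sim p_{\theta^*}}[\phi(y)]$ is invertible. Let $\alpha>0$ and $q_\alpha=e^{\alpha/2}/(1+e^{\alpha/2})$. The coordinate release mechanism with uniform coordinate sampling takes $y$, draws $j\in\{1,\dots,d\}$ uniformly, sets $b=\phi(y)[j]$ with probability $q_\alpha$ and $b=1-\phi(y)[j]$ otherwise, and releases $o=(j,b)$; let $S(o\mid y)$ be its conditional distribution. Let $\beta(j,b)=d\,\frac{b-1+q_\alpha}{2q_\alpha-1}\,e_j$, where $e_j$ is the $j$-th standard basis vector. Let $(y^{(i)},o^{(i)})_{i\ge1}$ be i.i.d. with $y^{(i)}\sim p_{\theta^*}$ and $o^{(i)}\mid y^{(i)}\sim S(\cdot\mid y^{(i)})$, let $\hat\mu_n=\frac1n\sum_{i=1}^n\beta(o^{(i)})$,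 and let the moment-based estimator $\hat\theta_n$ be a (measurable) element of $\arg\max_\theta\{\hat\mu_n^\top\theta-A(\theta)\}$ whenever this set is nonempty (with an arbitrary value otherwise). **Theorem (Asymptotic variance, coordinate release).** The mechanism is $\alpha$-differentially private, i.e. $S(o\mid y)\le e^{\alpha}S(o\mid y')$ for all $o,y,y'$, and the moment-based estimator has asymptotic variance $\mathcal I^{-1}+\mathcal I^{-1}H\mathcal I^{-1}$, i.e. $$\sqrt n\,(\hat\theta_n-\theta^*)\ \xrightarrow{d}\ \mathcal N\bigl(0,\ \mathcal I^{-1}+\mathcal I^{-1}H\mathcal I^{-1}\bigr),$$ where, with $I_d$ the $d\times d$ identity matrix, $$H=\frac{d\,q_\alpha(1-q_\alpha)}{(2q_\alpha-1)^2}\,I_d+\mathbb E_{y\sim p_{\theta^*}}\bigl[d\,\operatorname{diag}(\phi(y))^2-\phi(y)\phi(y)^\top\bigr].$$ -/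

import Mathlib

open MeasureTheory ProbabilityTheory Filter Topology Matrix
open scoped ENNReal

noncomputable section

namespace IndirectSupervision

/-! ### Exponential family over a finite label set -/

section Model

variable {Y : Type*} [Fintype Y] {d : ℕ}

/-- Log-partition function `A(θ) = log ∑_y exp (φ(y)ᵀ θ)`. -/
def logPartition (φ : Y → EuclideanSpace ℝ (Fin d)) (θ : EuclideanSpace ℝ (Fin d)) : ℝ :=
  Real.log (∑ y, Real.exp (inner ℝ (φ y) θ))

/-- The model density `p_θ(y) = exp (φ(y)ᵀ θ - A(θ))`. -/
def modelDensity (φ : Y → EuclideanSpace ℝ (Fin d)) (θ : EuclideanSpace ℝ (Fin d)) (y : Y) : ℝ :=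
  Real.exp (inner ℝ (φ y) θ - logPartition φ θ)

theorem sum_modelDensity [Nonempty Y] (φ : Y → EuclideanSpace ℝ (Fin d))
    (θ : EuclideanSpace ℝ (Fin d)) : ∑ y, modelDensity φ θ y = 1 := by
  have h : 0 < ∑ y, Real.exp (inner ℝ (φ y) θ) :=
    Finset.sum_pos (fun y _ => Real.exp_pos _) Finset.univ_nonempty
  simp only [modelDensity, logPartition, Real.exp_sub, Real.exp_log h]
  rw [← Finset.sum_div, div_self h.ne']

/-- The model `p_θ` as a probability distribution on `Y`. -/
def model [Nonempty Y] (φ : Y → EuclideanSpace ℝ (Fin d)) (θ : EuclideanSpace ℝ (Fin d)) : PMF Y :=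
  PMF.ofFintype (fun y => ENNReal.ofReal (modelDensity φ θ y)) (by
    have h0 : ∀ y ∈ Finset.univ, 0 ≤ modelDensity φ θ y := fun y _ => (Real.exp_pos _).le
    rw [← ENNReal.ofReal_sum_of_nonneg h0, sum_modelDensity, ENNReal.ofReal_one])

/-- Fisher information `Cov[φ(y)]` for `y ∼ p_θ`. -/
def fisherInformation [Nonempty Y] [MeasurableSpace Y] (φ : Y → EuclideanSpace ℝ (Fin d))
    (θ : EuclideanSpace ℝ (Fin d)) : Matrix (Fin d) (Fin d) ℝ :=
  Matrix.of fun i j => cov[fun y => φ y i, fun y => φ y j; (model φ θ).toMeasure]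

end Model

/-! ### The coordinate release mechanism -/

/-- The distribution of a Boolean equal to `true` with probability `p`
(`p` is truncated to `[0, 1]`). -/
def bern (p : ℝ) : PMF Bool :=
  PMF.ofFintype (fun b => bif b then min (ENNReal.ofReal p) 1 else 1 - min (ENNReal.ofReal p) 1)
    (by simp)

/-- `q_t = e^{t/2} / (1 + e^{t/2})`. -/
def keepProb (t : ℝ) : ℝ := Real.exp (t / 2) / (1 + Real.exp (t / 2))

/-- Binarization of a vector `v` with coordinates in `[0, c]`: independent bits, the `i`-th one
being `1` with probability `v i / c`. -/
def binarize {d : ℕ} (c : ℝ) (v : EuclideanSpace ℝ (Fin d)) : PMF (Fin d → Bool) :=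
  PMF.ofFintype (fun t => ∏ i, bern (v i / c) (t i)) (by
    rw [← Fintype.piFinset_univ, ← Finset.prod_univ_sum]
    refine Finset.prod_eq_one fun i _ => ?_
    rw [← tsum_fintype (L := .unconditional _)]
    exact (bern (v i / c)).tsum_coe)

/-- Coordinate release of a vector `v` with coordinates in `[0, c]`: binarize `v` to `t`, draw a
coordinate `j ∼ p`, keep the bit `t j` with probability `q_α` and flip it otherwise, and release `j`
with the resulting bit. -/
def coordinateRelease {d : ℕ} (p : PMF (Fin d)) (α c : ℝ) (v : EuclideanSpace ℝ (Fin d)) :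
    PMF (Fin d × Bool) :=
  (binarize c v).bind fun t => p.bind fun j =>
    (bern (keepProb α)).map fun keep => (j, if keep then t j else !(t j))

/-- The observation function
`β(j, o) = p(j)⁻¹ * (o - 1 + q_α) / (2 q_α - 1) * c * e_j`. -/
def coordinateReleaseObs {d : ℕ} (p : PMF (Fin d)) (α c : ℝ) (o : Fin d × Bool) :
    EuclideanSpace ℝ (Fin d) :=
  ((p o.1).toReal⁻¹ * (((if o.2 then 1 else 0) - 1 + keepProb α) / (2 * keepProb α - 1)) * c) •
    EuclideanSpace.single o.1 (1 : ℝ)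

/-- `S` is `α`-differentially private: `S(o ∣ y) ≤ e^α S(o ∣ y')` for all `o, y, y'`. -/
def IsDifferentiallyPrivate {Y O : Type*} (S : Y → PMF O) (α : ℝ) : Prop :=
  ∀ (o : O) (y y' : Y), S y o ≤ ENNReal.ofReal (Real.exp α) * S y' o

/-! ### Moment-based estimation -/

/-- The joint distribution of `(y, o)` when `y ∼ π` and `o ∼ S(· ∣ y)`. -/
def jointLaw {Y O : Type*} (π : PMF Y) (S : Y → PMF O) : PMF (Y × O) :=
  π.bind fun y => (S y).map fun o => (y, o)

/-- The empirical mean `μ̂` of the observation function over the first `n` observations. -/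
def empiricalMoment {O : Type*} {d : ℕ} (β : O → EuclideanSpace ℝ (Fin d)) (n : ℕ) (o : ℕ → O) :
    EuclideanSpace ℝ (Fin d) :=
  (n : ℝ)⁻¹ • ∑ i ∈ Finset.range n, β (o i)

/-- `θhat ∈ argmax_θ {μhatᵀ θ - A(θ)}` whenever this set is nonempty; the value of the estimator is
unrestricted for those `μhat` for which no maximizer exists. -/
def IsMomentEstimate {Y : Type*} [Fintype Y] {d : ℕ} (φ : Y → EuclideanSpace ℝ (Fin d))
    (μhat θhat : EuclideanSpace ℝ (Fin d)) : Prop :=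
  (∃ θ, IsMaxOn (fun θ' => inner ℝ μhat θ' - logPartition φ θ') Set.univ θ) →
    IsMaxOn (fun θ' => inner ℝ μhat θ' - logPartition φ θ') Set.univ θhat

/-- The estimators `θhat n` of `θ` have asymptotic variance `V`:
`√n (θhat n - θ)` converges in distribution to `N(0, V)`. -/
def HasAsymptoticVariance {Ω : Type*} [MeasurableSpace Ω] (P : Measure Ω) [IsProbabilityMeasure P]
    {d : ℕ} (θhat : ℕ → Ω → EuclideanSpace ℝ (Fin d)) (θ : EuclideanSpace ℝ (Fin d))
    (V : Matrix (Fin d) (Fin d) ℝ) : Prop :=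
  V.PosSemidef ∧
    TendstoInDistribution (fun (n : ℕ) ω => √(n : ℝ) • (θhat n ω - θ)) atTop
      (id : EuclideanSpace ℝ (Fin d) → EuclideanSpace ℝ (Fin d)) (fun _ => P)
      (multivariateGaussian 0 V)

/-- `H = d q_α (1 - q_α) / (2 q_α - 1)² I + E[d diag(φ(y))² - φ(y) φ(y)ᵀ]`, `y ∼ π`,
with the expectation taken entrywise. -/
def coordinateReleaseLoss {Y : Type*} [MeasurableSpace Y] {d : ℕ}
    (φ : Y → EuclideanSpace ℝ (Fin d)) (π : PMF Y) (α : ℝ) : Matrix (Fin d) (Fin d) ℝ :=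
  ((d : ℝ) * keepProb α * (1 - keepProb α) / (2 * keepProb α - 1) ^ 2) •
      (1 : Matrix (Fin d) (Fin d) ℝ) +
    Matrix.of fun i j => ∫ y, ((d : ℝ) • (Matrix.diagonal fun k => φ y k) ^ 2 -
      Matrix.vecMulVec (fun k => φ y k) (fun k => φ y k)) i j ∂π.toMeasure

end IndirectSupervision

end

/-!
The log-partition function `A` is convex with gradient the mean parameter `θ ↦ E[φ(y)]`, whose
derivative is the Fisher information `I`. Near the true moment the inverse function theorem provides
a local inverse of the mean parameter, with derivative `I⁻¹`; its values are critical points of the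
moment objective, hence maximizers, and unique ones because `A` is strictly convex when `I` is
invertible. The empirical moment is asymptotically normal by the multivariate central limit theorem
(Cramér–Wold), so by the delta method the estimator has asymptotic variance `I⁻¹ Cov[β(o)] I⁻¹`.
When `β` is conditionally unbiased, the law of total covariance splits `Cov[β(o)]` into `I` and the
mean covariance `H` of `β` under the release channel, which yields `I⁻¹ + I⁻¹ H I⁻¹`.

Since only one coordinate is released, binarizing the whole vector and then sampling a coordinate
amounts to sampling `j` first, drawing the single bit `t j`, and passing it through randomized
response. Privacy then comes from the likelihood ratio `q / (1 - q) = exp (α / 2)` of randomized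
response, and `β` is the inverse-probability-weighted estimate built from the debiased released bit.
-/

namespace IndirectSupervision

theorem exists_continuousLinearEquiv_toEuclideanCLM {ι : Type*} [Fintype ι] [DecidableEq ι]
    {A : Matrix ι ι ℝ} (hA : IsUnit A) :
    ∃ e : EuclideanSpace ℝ ι ≃L[ℝ] EuclideanSpace ℝ ι,
      (e : EuclideanSpace ℝ ι →L[ℝ] EuclideanSpace ℝ ι) = toEuclideanCLM (𝕜 := ℝ) A ∧
      (e.symm : EuclideanSpace ℝ ι →L[ℝ] EuclideanSpace ℝ ι) = toEuclideanCLM (𝕜 := ℝ) A⁻¹ := by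
  obtain ⟨u, rfl⟩ := hA
  refine ⟨ContinuousLinearEquiv.unitsEquiv ℝ _
    (Units.map (toEuclideanCLM (n := ι) (𝕜 := ℝ) : _ →* _) u), rfl, ?_⟩
  rw [← coe_units_inv]
  rfl

section Covariance

variable {Ω ι : Type*} [MeasurableSpace Ω] {P : Measure Ω} {X : Ω → EuclideanSpace ℝ ι}

/-- The covariance matrix of a random vector. -/
noncomputable def covarianceMatrix (X : Ω → EuclideanSpace ℝ ι) (P : Measure Ω) : Matrix ι ι ℝ :=
  Matrix.of fun i j => cov[fun ω => X ω i, fun ω => X ω j; P]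

theorem covarianceMatrix_transpose : (covarianceMatrix X P)ᵀ = covarianceMatrix X P := by
  ext i j
  exact covariance_comm _ _

theorem covarianceMatrix_comp_of_hasLaw {Ω' : Type*} [MeasurableSpace Ω'] {μ : Measure Ω'}
    {Y : Ω → Ω'} (hY : HasLaw Y μ P) {β : Ω' → EuclideanSpace ℝ ι} (hβ : AEMeasurable β μ) :
    covarianceMatrix (fun ω => β (Y ω)) P = covarianceMatrix β μ := by
  ext i j
  exact hY.covariance_fun_comp (f := fun x => β x i) (g := fun x => β x j) (by fun_prop)
    (by fun_prop)

variable [Fintype ι] [IsFiniteMeasure P]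

theorem dotProduct_covarianceMatrix_mulVec (hX : MemLp X 2 P) (u v : EuclideanSpace ℝ ι) :
    u ⬝ᵥ covarianceMatrix X P *ᵥ v =
      cov[fun ω => inner ℝ u (X ω), fun ω => inner ℝ v (X ω); P] := by
  have hXi : ∀ i, MemLp (fun ω => X ω i) 2 P := hX.eval_piLp
  simp only [PiLp.inner_apply, RCLike.inner_apply, conj_trivial]
  rw [covariance_fun_sum_fun_sum (fun i => (hXi i).mul_const _) fun i => (hXi i).mul_const _]
  simp only [covariance_mul_const_left, covariance_mul_const_right, dotProduct, mulVec,
    covarianceMatrix, Matrix.of_apply, Finset.mul_sum]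
  exact Finset.sum_congr rfl fun i _ => Finset.sum_congr rfl fun j _ => by ring

theorem posSemidef_covarianceMatrix (hX : MemLp X 2 P) : (covarianceMatrix X P).PosSemidef := by
  refine .of_dotProduct_mulVec_nonneg
    ((conjTranspose_eq_transpose_of_trivial _).trans covarianceMatrix_transpose) fun x => ?_
  have h := dotProduct_covarianceMatrix_mulVec hX (WithLp.toLp 2 x) (WithLp.toLp 2 x)
  rw [covariance_self (hX.const_inner _).aestronglyMeasurable.aemeasurable] at h
  exact (variance_nonneg _ _).trans_eq h.symm

end Covariance

section Gaussian

variable {ι : Type*} [Fintype ι] [DecidableEq ι] {S : Matrix ι ι ℝ}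

theorem hasLaw_inner_multivariateGaussian (hS : S.PosSemidef) (m t : EuclideanSpace ℝ ι) :
    HasLaw (fun x => inner ℝ t x) (gaussianReal (inner ℝ t m) (t ⬝ᵥ S *ᵥ t).toNNReal)
      (multivariateGaussian m S) where
  aemeasurable := by fun_prop
  map_eq := by
    have h := IsGaussian.map_eq_gaussianReal (μ := multivariateGaussian m S) (innerSL ℝ t)
    rw [(innerSL ℝ t).integral_comp_id_comm IsGaussian.integrable_id,
      integral_id_multivariateGaussian] at h
    rw [← covarianceBilin_multivariateGaussian (μ := m) hS,
      covarianceBilin_self IsGaussian.memLp_two_id]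
    exact h

theorem map_multivariateGaussian_toEuclideanCLM (hS : S.PosSemidef) (A : Matrix ι ι ℝ)
    (m : EuclideanSpace ℝ ι) :
    (multivariateGaussian m S).map (toEuclideanCLM (𝕜 := ℝ) A) =
      multivariateGaussian (toEuclideanCLM (𝕜 := ℝ) A m) (A * S * Aᵀ) := by
  have hASA : (A * S * Aᵀ).PosSemidef := by
    simpa only [conjTranspose_eq_transpose_of_trivial] using hS.mul_mul_conjTranspose_same A
  refine IsGaussian.ext ?_ ?_
  · rw [integral_map (by fun_prop) (by fun_prop)]
    simp only [id]
    rw [ContinuousLinearMap.integral_comp_comm _ IsGaussian.integrable_fun_id,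
      integral_id_multivariateGaussian, integral_id_multivariateGaussian]
  · have hadj : (toEuclideanCLM (𝕜 := ℝ) A).adjoint = toEuclideanCLM (𝕜 := ℝ) Aᵀ := by
      rw [← conjTranspose_eq_transpose_of_trivial, ← star_eq_conjTranspose, map_star]
      rfl
    ext u v
    rw [covarianceBilin_map IsGaussian.memLp_two_id, hadj,
      covarianceBilin_multivariateGaussian hS, covarianceBilin_multivariateGaussian hASA]
    simp only [ofLp_toEuclideanCLM, ← mulVec_mulVec, mulVec_transpose, dotProduct_mulVec]

end Gaussian

section Limits

variable {Ω Ω' E F : Type*} [MeasurableSpace Ω] [MeasurableSpace Ω'] {P : Measure Ω}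
  {P' : Measure Ω'}

section CramerWold

variable [NormedAddCommGroup E] [InnerProductSpace ℝ E] [MeasurableSpace E] [BorelSpace E]

theorem charFun_map_eq_charFun_map_inner [SecondCountableTopology E] {X : Ω → E}
    (hX : AEMeasurable X P) (t : E) :
    charFun (P.map X) t = charFun (P.map fun ω => inner ℝ t (X ω)) 1 := by
  have ht : AEMeasurable (fun ω => inner ℝ t (X ω)) P := by fun_prop
  rw [charFun_apply, charFun_apply, integral_map hX (by fun_prop), integral_map ht (by fun_prop)]
  simp [real_inner_comm t]

theorem tendstoInDistribution_of_inner [IsProbabilityMeasure P] [IsProbabilityMeasure P']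
    [FiniteDimensional ℝ E] {X : ℕ → Ω → E} {Z : Ω' → E} (hX : ∀ n, AEMeasurable (X n) P)
    (hZ : AEMeasurable Z P')
    (h : ∀ t : E, TendstoInDistribution (fun n ω => inner ℝ t (X n ω)) atTop
      (fun ω => inner ℝ t (Z ω)) (fun _ => P) P') :
    TendstoInDistribution X atTop Z (fun _ => P) P' := by
  refine ⟨hX, hZ, ProbabilityMeasure.tendsto_iff_tendsto_charFun.2 fun t => ?_⟩
  simpa only [ProbabilityMeasure.coe_mk, charFun_map_eq_charFun_map_inner (hX _),
    charFun_map_eq_charFun_map_inner hZ] using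
    ProbabilityMeasure.tendsto_iff_tendsto_charFun.1 (h t).tendsto 1

end CramerWold

variable [IsProbabilityMeasure P] [IsProbabilityMeasure P']

theorem sqrt_mul_average_sub (n : ℕ) (x : ℕ → ℝ) (m : ℝ) :
    √(n : ℝ) * ((n : ℝ)⁻¹ * ∑ i ∈ Finset.range n, x i - m) =
      (√(n : ℝ))⁻¹ * (∑ i ∈ Finset.range n, x i - n * m) := by
  rcases Nat.eq_zero_or_pos n with rfl | hn
  · simp
  have hsqrt : √(n : ℝ) ≠ 0 := by positivity
  field_simp
  rw [Real.sq_sqrt n.cast_nonneg]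

theorem tendstoInDistribution_sqrt_smul_average_sub {ι : Type*} [Fintype ι] [DecidableEq ι]
    {X : ℕ → Ω → EuclideanSpace ℝ ι} {Z : Ω' → EuclideanSpace ℝ ι}
    (hZ : HasLaw Z (multivariateGaussian 0 (covarianceMatrix (X 0) P)) P')
    (hX : MemLp (X 0) 2 P) (hindep : iIndepFun X P)
    (hident : ∀ i, IdentDistrib (X i) (X 0) P P) :
    TendstoInDistribution
      (fun (n : ℕ) ω => √(n : ℝ) • ((n : ℝ)⁻¹ • ∑ i ∈ Finset.range n, X i ω - P[X 0])) atTop Z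
      (fun _ => P) P' := by
  have hm (i : ℕ) : AEMeasurable (X i) P := (hident i).aemeasurable_fst
  refine tendstoInDistribution_of_inner (fun n => ?_) hZ.aemeasurable fun t => ?_
  · have := Finset.aemeasurable_fun_sum (Finset.range n) fun i _ => hm i
    fun_prop
  have hlaw : HasLaw (fun ω => inner ℝ t (Z ω))
      (gaussianReal 0 Var[fun ω => inner ℝ t (X 0 ω); P].toNNReal) P' := by
    have h := (hasLaw_inner_multivariateGaussian (posSemidef_covarianceMatrix hX) 0 t).comp hZ
    rwa [dotProduct_covarianceMatrix_mulVec hX, inner_zero_right,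
      covariance_self (hX.const_inner t).aestronglyMeasurable.aemeasurable] at h
  have hclt := tendstoInDistribution_inv_sqrt_mul_sum_sub hlaw
    (X := fun i ω => inner ℝ t (X i ω)) (hX.const_inner t)
    (hindep.comp (fun _ x => inner ℝ t x) (by fun_prop))
    (fun i => (hident i).comp (u := fun x => inner ℝ t x) (by fun_prop))
  simpa only [inner_smul_right, inner_sub_right, inner_sum, sqrt_mul_average_sub,
    integral_inner (hX.integrable one_le_two)] using hclt

theorem tendstoInDistribution_of_eventually_eq [NormedAddCommGroup F] [MeasurableSpace F]
    [BorelSpace F] [SecondCountableTopology F] {X T : ℕ → Ω → F} {Z : Ω' → F}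
    (hX : TendstoInDistribution X atTop Z (fun _ => P) P') (hT : ∀ n, AEMeasurable (T n) P)
    (hTX : ∀ᵐ ω ∂P, ∀ᶠ n in atTop, T n ω = X n ω) :
    TendstoInDistribution T atTop Z (fun _ => P) P' := by
  refine tendstoInDistribution_of_tendstoInMeasure_sub T Z hX
    (tendstoInMeasure_of_tendsto_ae
      (fun n => ((hT n).sub (hX.forall_aemeasurable n)).aestronglyMeasurable) ?_) hT
  filter_upwards [hTX] with ω hω
  refine tendsto_const_nhds.congr' ?_
  filter_upwards [hω] with n hn
  simp [hn]

theorem tendstoInDistribution_of_identDistrib_limit {Ω'' : Type*} [MeasurableSpace Ω'']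
    {P'' : Measure Ω''} [IsProbabilityMeasure P''] [TopologicalSpace E] [MeasurableSpace E]
    [OpensMeasurableSpace E] {ι : Type*} {l : Filter ι} {X : ι → Ω → E} {Z : Ω' → E} {W : Ω'' → E}
    (hX : TendstoInDistribution X l Z (fun _ => P) P') (hZW : IdentDistrib Z W P' P'') :
    TendstoInDistribution X l W (fun _ => P) P'' where
  forall_aemeasurable := hX.forall_aemeasurable
  aemeasurable_limit := hZW.aemeasurable_snd
  tendsto := by simpa only [hZW.map_eq] using hX.tendsto

theorem tendstoInDistribution_of_hasFDerivAt [NormedAddCommGroup E] [NormedSpace ℝ E]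
    [MeasurableSpace E] [BorelSpace E] [SecondCountableTopology E] [NormedAddCommGroup F]
    [NormedSpace ℝ F] [MeasurableSpace F] [BorelSpace F] [SecondCountableTopology F]
    {X : ℕ → Ω → E} {T : ℕ → Ω → F} {Z : Ω' → E} {m : E} {ψ : E → F} {L : E →L[ℝ] F}
    {r : ℕ → ℝ} (hψ : HasFDerivAt ψ L m) (hX : ∀ n, AEMeasurable (X n) P)
    (hT : ∀ n, AEMeasurable (T n) P) (hr : ∀ n, 0 ≤ r n)
    (hZ : TendstoInDistribution (fun n ω => r n • (X n ω - m)) atTop Z (fun _ => P) P')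
    (hlim : ∀ᵐ ω ∂P, Tendsto (fun n => X n ω) atTop (𝓝 m))
    (hTX : ∀ᵐ ω ∂P, ∀ᶠ n in atTop, T n ω = ψ (X n ω)) :
    TendstoInDistribution (fun n ω => r n • (T n ω - ψ m)) atTop (fun ω => L (Z ω))
      (fun _ => P) P' := by
  -- `T - ψ m = L (X - m) + ‖X - m‖ • w` with `w → 0`, so Slutsky's theorem applies after scaling.
  set w : ℕ → Ω → F := fun n ω => ‖X n ω - m‖⁻¹ • (T n ω - ψ m - L (X n ω - m)) with hw
  have hwm (n : ℕ) : AEMeasurable (w n) P := by fun_prop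
  have hwlim : ∀ᵐ ω ∂P, Tendsto (fun n => w n ω) atTop (𝓝 0) := by
    filter_upwards [hlim, hTX] with ω hXω hTω
    refine tendsto_zero_iff_norm_tendsto_zero.2
      (((hasFDerivAt_iff_tendsto.1 hψ).comp hXω).congr' ?_)
    filter_upwards [hTω] with n hn
    simp [hw, hn, norm_smul]
  have hslutsky := hZ.continuous_comp_prodMk_of_tendstoInMeasure_const
    (g := fun x : E × F => L x.1 + ‖x.1‖ • x.2) (by fun_prop)
    (tendstoInMeasure_of_tendsto_ae (fun n => (hwm n).aestronglyMeasurable) hwlim) hwm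
  simp only [smul_zero, add_zero] at hslutsky
  refine tendstoInDistribution_of_eventually_eq hslutsky
    (fun n => ((hT n).sub_const _).const_smul _) ?_
  filter_upwards [hTX] with ω hTω
  filter_upwards [hTω] with n hn
  rcases eq_or_ne (X n ω) m with hXm | hXm
  · simp [hn, hXm]
  · rw [hw, norm_smul, Real.norm_of_nonneg (hr n), map_smul, smul_smul, mul_assoc,
      mul_inv_cancel₀ (norm_ne_zero_iff.2 (sub_ne_zero.2 hXm)), mul_one, ← smul_add,
      add_sub_cancel]

end Limits

section ExponentialFamily

variable {Y : Type*} [Fintype Y] {d : ℕ} {φ : Y → EuclideanSpace ℝ (Fin d)}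

theorem modelDensity_pos (φ : Y → EuclideanSpace ℝ (Fin d)) (θ : EuclideanSpace ℝ (Fin d)) (y : Y) :
    0 < modelDensity φ θ y := Real.exp_pos _

/-- The mean parameter `E[φ(y)]`, `y ∼ p_θ`, of the exponential family: the moment equation for
`θ` prescribes its value. -/
noncomputable def meanParam (φ : Y → EuclideanSpace ℝ (Fin d)) (θ : EuclideanSpace ℝ (Fin d)) :
    EuclideanSpace ℝ (Fin d) :=
  ∑ y, modelDensity φ θ y • φ y

theorem inner_meanParam (φ : Y → EuclideanSpace ℝ (Fin d)) (θ u : EuclideanSpace ℝ (Fin d)) :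
    inner ℝ u (meanParam φ θ) = ∑ y, modelDensity φ θ y * inner ℝ u (φ y) := by
  simp [meanParam, inner_sum, inner_smul_right]

variable [Nonempty Y]

theorem toReal_model (φ : Y → EuclideanSpace ℝ (Fin d)) (θ : EuclideanSpace ℝ (Fin d)) (y : Y) :
    (model φ θ y).toReal = modelDensity φ θ y := by
  simp [model, ENNReal.toReal_ofReal (modelDensity_pos φ θ y).le]

theorem exp_logPartition (φ : Y → EuclideanSpace ℝ (Fin d)) (θ : EuclideanSpace ℝ (Fin d)) :
    Real.exp (logPartition φ θ) = ∑ y, Real.exp (inner ℝ (φ y) θ) :=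
  Real.exp_log (Finset.sum_pos (fun _ _ => Real.exp_pos _) Finset.univ_nonempty)

theorem hasStrictFDerivAt_logPartition (φ : Y → EuclideanSpace ℝ (Fin d))
    (θ : EuclideanSpace ℝ (Fin d)) :
    HasStrictFDerivAt (logPartition φ) (innerSL ℝ (meanParam φ θ)) θ := by
  have hexp (y : Y) : HasStrictFDerivAt (fun θ => Real.exp (inner ℝ (φ y) θ))
      (Real.exp (inner ℝ (φ y) θ) • innerSL ℝ (φ y)) θ :=
    (innerSL ℝ (φ y)).hasStrictFDerivAt.exp
  refine ((HasStrictFDerivAt.fun_sum fun y (_ : y ∈ Finset.univ) => hexp y).log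
    (exp_logPartition φ θ ▸ (Real.exp_pos _).ne')).congr_fderiv ?_
  rw [← exp_logPartition, meanParam, map_sum, Finset.smul_sum]
  refine Finset.sum_congr rfl fun y _ => ?_
  rw [smul_smul, map_smul, modelDensity, Real.exp_sub, div_eq_inv_mul]

theorem sum_modelDensity_mul_exp (φ : Y → EuclideanSpace ℝ (Fin d))
    (θ v : EuclideanSpace ℝ (Fin d)) :
    ∑ y, modelDensity φ θ y * Real.exp (inner ℝ v (φ y)) =
      Real.exp (logPartition φ (θ + v) - logPartition φ θ) := by
  rw [Real.exp_sub, exp_logPartition, Finset.sum_div]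
  refine Finset.sum_congr rfl fun y _ => ?_
  rw [modelDensity, inner_add_right, Real.exp_add, Real.exp_sub, real_inner_comm v]
  ring

theorem inner_meanParam_le_logPartition_sub (φ : Y → EuclideanSpace ℝ (Fin d))
    (θ v : EuclideanSpace ℝ (Fin d)) :
    inner ℝ v (meanParam φ θ) ≤ logPartition φ (θ + v) - logPartition φ θ := by
  rw [← Real.exp_le_exp, ← sum_modelDensity_mul_exp, inner_meanParam]
  exact convexOn_exp.map_sum_le (fun y _ => (modelDensity_pos φ θ y).le) (sum_modelDensity φ θ)
    fun _ _ => Set.mem_univ _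

theorem inner_eq_of_logPartition_sub_le {θ v : EuclideanSpace ℝ (Fin d)}
    (h : logPartition φ (θ + v) - logPartition φ θ ≤ inner ℝ v (meanParam φ θ)) (y y' : Y) :
    inner ℝ v (φ y) = inner ℝ v (φ y') := by
  rw [← Real.exp_le_exp, ← sum_modelDensity_mul_exp, inner_meanParam] at h
  exact strictConvexOn_exp.eq_of_le_map_sum (fun y _ => modelDensity_pos φ θ y)
    (sum_modelDensity φ θ) (fun _ _ => Set.mem_univ _) h (Finset.mem_univ _) (Finset.mem_univ _)

theorem isMaxOn_inner_meanParam_sub_logPartition (φ : Y → EuclideanSpace ℝ (Fin d))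
    (θ : EuclideanSpace ℝ (Fin d)) :
    IsMaxOn (fun θ' => inner ℝ (meanParam φ θ) θ' - logPartition φ θ') Set.univ θ := by
  refine isMaxOn_iff.2 fun θ' _ => ?_
  have h := inner_meanParam_le_logPartition_sub φ θ (θ' - θ)
  rw [real_inner_comm, inner_sub_right, add_sub_cancel] at h
  linarith

section FisherInformation

variable [MeasurableSpace Y] [DiscreteMeasurableSpace Y]

theorem integral_model {E : Type*} [NormedAddCommGroup E] [NormedSpace ℝ E] [CompleteSpace E]
    (φ : Y → EuclideanSpace ℝ (Fin d)) (θ : EuclideanSpace ℝ (Fin d)) (f : Y → E) :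
    ∫ y, f y ∂(model φ θ).toMeasure = ∑ y, modelDensity φ θ y • f y := by
  simp only [PMF.integral_eq_sum, toReal_model]

theorem dotProduct_fisherInformation_mulVec (φ : Y → EuclideanSpace ℝ (Fin d))
    (θ u v : EuclideanSpace ℝ (Fin d)) :
    u ⬝ᵥ fisherInformation φ θ *ᵥ v =
      cov[fun y => inner ℝ u (φ y), fun y => inner ℝ v (φ y); (model φ θ).toMeasure] :=
  dotProduct_covarianceMatrix_mulVec .of_discrete u v

theorem hasStrictFDerivAt_meanParam (φ : Y → EuclideanSpace ℝ (Fin d))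
    (θ : EuclideanSpace ℝ (Fin d)) :
    HasStrictFDerivAt (meanParam φ) (toEuclideanCLM (𝕜 := ℝ) (fisherInformation φ θ)) θ := by
  have hdensity (y : Y) : HasStrictFDerivAt (fun θ => modelDensity φ θ y)
      (modelDensity φ θ y • (innerSL ℝ (φ y) - innerSL ℝ (meanParam φ θ))) θ :=
    ((innerSL ℝ (φ y)).hasStrictFDerivAt.sub (hasStrictFDerivAt_logPartition φ θ)).exp
  refine (HasStrictFDerivAt.fun_sum fun y (_ : y ∈ Finset.univ) =>
    (hdensity y).smul_const (φ y)).congr_fderiv (ContinuousLinearMap.ext fun v =>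
      ext_inner_left ℝ fun u => ?_)
  rw [inner_toEuclideanCLM, dotProduct_fisherInformation_mulVec,
    covariance_eq_sub .of_discrete .of_discrete]
  simp only [integral_model, smul_eq_mul, Pi.mul_apply, ← inner_meanParam φ θ v]
  rw [Finset.sum_mul, ← Finset.sum_sub_distrib, _root_.sum_apply, inner_sum]
  refine Finset.sum_congr rfl fun y _ => ?_
  simp [inner_smul_right, real_inner_comm v]
  ring

theorem eq_zero_of_forall_inner_eq {θ v : EuclideanSpace ℝ (Fin d)}
    (hI : IsUnit (fisherInformation φ θ)) (h : ∀ y y', inner ℝ v (φ y) = inner ℝ v (φ y')) :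
    v = 0 := by
  obtain ⟨y₀⟩ := ‹Nonempty Y›
  have hker : fisherInformation φ θ *ᵥ v.ofLp = 0 := by
    refine dotProduct_eq_zero _ fun w => ?_
    have hw := dotProduct_fisherInformation_mulVec φ θ (WithLp.toLp 2 w) v
    simp only [h _ y₀, covariance_const_right] at hw
    rwa [dotProduct_comm]
  exact WithLp.ofLp_injective 2 (mulVec_injective_of_isUnit hI (hker.trans (mulVec_zero _).symm))

theorem eq_of_isMomentEstimate_meanParam {θ₀ θ θhat : EuclideanSpace ℝ (Fin d)}
    (hI : IsUnit (fisherInformation φ θ₀)) (h : IsMomentEstimate φ (meanParam φ θ) θhat) :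
    θhat = θ := by
  have hmax := isMaxOn_iff.1 (h ⟨θ, isMaxOn_inner_meanParam_sub_logPartition φ θ⟩) θ trivial
  refine sub_eq_zero.1 (eq_zero_of_forall_inner_eq hI (inner_eq_of_logPartition_sub_le (θ := θ) ?_))
  rw [real_inner_comm, inner_sub_right, add_sub_cancel]
  linarith

theorem exists_hasFDerivAt_momentEstimate {θ : EuclideanSpace ℝ (Fin d)}
    (hI : IsUnit (fisherInformation φ θ)) :
    ∃ ψ : EuclideanSpace ℝ (Fin d) → EuclideanSpace ℝ (Fin d),
      HasFDerivAt ψ (toEuclideanCLM (𝕜 := ℝ) (fisherInformation φ θ)⁻¹) (meanParam φ θ) ∧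
      ψ (meanParam φ θ) = θ ∧
      ∀ᶠ μ in 𝓝 (meanParam φ θ), ∀ θhat, IsMomentEstimate φ μ θhat → θhat = ψ μ := by
  obtain ⟨e, he, hesymm⟩ := exists_continuousLinearEquiv_toEuclideanCLM hI
  have hderiv : HasStrictFDerivAt (meanParam φ) (e : _ →L[ℝ] _) θ :=
    he ▸ hasStrictFDerivAt_meanParam φ θ
  refine ⟨hderiv.localInverse, hesymm ▸ hderiv.to_localInverse.hasFDerivAt,
    hderiv.localInverse_apply_image, ?_⟩
  filter_upwards [hderiv.eventually_right_inverse] with μ hμ θhat hθhat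
  exact eq_of_isMomentEstimate_meanParam hI (hμ.symm ▸ hθhat)

end FisherInformation

end ExponentialFamily

section AsymptoticVariance

variable {Y Ω : Type*} [Fintype Y] [Nonempty Y] [MeasurableSpace Y] [DiscreteMeasurableSpace Y]
  [MeasurableSpace Ω] {P : Measure Ω} [IsProbabilityMeasure P] {d : ℕ}
  {φ : Y → EuclideanSpace ℝ (Fin d)} {θ : EuclideanSpace ℝ (Fin d)}

theorem hasAsymptoticVariance_of_isMomentEstimate (hI : IsUnit (fisherInformation φ θ))
    {X : ℕ → Ω → EuclideanSpace ℝ (Fin d)} (hX : MemLp (X 0) 2 P) (hindep : iIndepFun X P)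
    (hident : ∀ i, IdentDistrib (X i) (X 0) P P) (hmean : P[X 0] = meanParam φ θ)
    {θhat : ℕ → Ω → EuclideanSpace ℝ (Fin d)} (hmeas : ∀ n, AEMeasurable (θhat n) P)
    (hest : ∀ n : ℕ, ∀ᵐ ω ∂P,
      IsMomentEstimate φ ((n : ℝ)⁻¹ • ∑ i ∈ Finset.range n, X i ω) (θhat n ω)) :
    HasAsymptoticVariance P θhat θ
      ((fisherInformation φ θ)⁻¹ * covarianceMatrix (X 0) P * (fisherInformation φ θ)⁻¹) := by
  have hS := posSemidef_covarianceMatrix hX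
  have hsymm : ((fisherInformation φ θ)⁻¹)ᵀ = (fisherInformation φ θ)⁻¹ := by
    rw [transpose_nonsing_inv]
    exact congrArg _ covarianceMatrix_transpose
  have hV := hS.mul_mul_conjTranspose_same (fisherInformation φ θ)⁻¹
  rw [conjTranspose_eq_transpose_of_trivial, hsymm] at hV
  obtain ⟨ψ, hψ, hψθ, hψest⟩ := exists_hasFDerivAt_momentEstimate hI
  have hlln := strong_law_ae X (hX.integrable one_le_two)
    (fun i j hij => hindep.indepFun hij) hident
  have hclt := tendstoInDistribution_sqrt_smul_average_sub HasLaw.id hX hindep hident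
  rw [hmean] at hlln hclt
  have hdelta := tendstoInDistribution_of_hasFDerivAt hψ
    (fun n => (Finset.aemeasurable_fun_sum (Finset.range n) fun i _ =>
      (hident i).aemeasurable_fst).const_smul (n : ℝ)⁻¹) hmeas (fun _ => Real.sqrt_nonneg _)
    hclt hlln (by
      filter_upwards [hlln, ae_all_iff.2 hest] with ω hlim hω
      filter_upwards [hlim.eventually hψest] with n hn using hn _ (hω n))
  rw [hψθ] at hdelta
  refine ⟨hV, tendstoInDistribution_of_identDistrib_limit hdelta
    ⟨by fun_prop, by fun_prop, ?_⟩⟩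
  have hmap := map_multivariateGaussian_toEuclideanCLM hS (fisherInformation φ θ)⁻¹ 0
  rw [map_zero, hsymm] at hmap
  rwa [Measure.map_id]

end AsymptoticVariance

section FiniteChannels

variable {Y O : Type*} [Finite Y] [MeasurableSpace Y] [DiscreteMeasurableSpace Y]
  [Finite O] [MeasurableSpace O] [DiscreteMeasurableSpace O]

theorem integral_bind {E : Type*} [NormedAddCommGroup E] [NormedSpace ℝ E] [CompleteSpace E]
    (π : PMF Y) (S : Y → PMF O) (f : O → E) :
    ∫ o, f o ∂(π.bind S).toMeasure = ∫ y, ∫ o, f o ∂(S y).toMeasure ∂π.toMeasure := by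
  have := Fintype.ofFinite Y
  have := Fintype.ofFinite O
  have hbind (o : O) : (π.bind S o).toReal = ∑ y, (π y).toReal * (S y o).toReal := by
    rw [PMF.bind_apply, tsum_fintype, ENNReal.toReal_sum fun y _ =>
      ENNReal.mul_ne_top (π.apply_ne_top y) ((S y).apply_ne_top o)]
    simp only [ENNReal.toReal_mul]
  simp only [PMF.integral_eq_sum, hbind, Finset.sum_smul, Finset.smul_sum, mul_smul]
  exact Finset.sum_comm

theorem covariance_bind (π : PMF Y) (S : Y → PMF O) (f g : O → ℝ) :
    cov[f, g; (π.bind S).toMeasure] =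
      cov[fun y => ∫ o, f o ∂(S y).toMeasure, fun y => ∫ o, g o ∂(S y).toMeasure; π.toMeasure] +
        ∫ y, cov[f, g; (S y).toMeasure] ∂π.toMeasure := by
  simp only [covariance_eq_sub MemLp.of_discrete MemLp.of_discrete, integral_bind,
    Pi.mul_apply]
  rw [integral_sub .of_finite .of_finite]
  ring

variable {ι : Type*}

/-- The expectation over `y ∼ π` of the covariance matrix of `β(o)`, `o ∼ S(· ∣ y)`: the
covariance that the channel `S` adds to that of the label. -/
noncomputable def channelCovariance (π : PMF Y) (S : Y → PMF O) (β : O → EuclideanSpace ℝ ι) :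
    Matrix ι ι ℝ :=
  Matrix.of fun i j => ∫ y, covarianceMatrix β (S y).toMeasure i j ∂π.toMeasure

theorem covarianceMatrix_bind [Fintype ι] (π : PMF Y) (S : Y → PMF O)
    (β : O → EuclideanSpace ℝ ι) :
    covarianceMatrix β (π.bind S).toMeasure =
      covarianceMatrix (fun y => ∫ o, β o ∂(S y).toMeasure) π.toMeasure +
        channelCovariance π S β := by
  ext i j
  simp only [covarianceMatrix, channelCovariance, Matrix.add_apply, Matrix.of_apply,
    covariance_bind, eval_integral_piLp fun _ => Integrable.of_finite]

end FiniteChannels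

theorem hasAsymptoticVariance_of_unbiased {Y O Ω : Type*} [Fintype Y] [Nonempty Y]
    [MeasurableSpace Y] [DiscreteMeasurableSpace Y] [Finite O] [MeasurableSpace O]
    [DiscreteMeasurableSpace O] [MeasurableSpace Ω] {P : Measure Ω} [IsProbabilityMeasure P]
    {d : ℕ} {φ : Y → EuclideanSpace ℝ (Fin d)}
    {θ : EuclideanSpace ℝ (Fin d)} (hI : IsUnit (fisherInformation φ θ)) {S : Y → PMF O}
    {β : O → EuclideanSpace ℝ (Fin d)} (hβ : ∀ y, ∫ x, β x ∂(S y).toMeasure = φ y)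
    {o : ℕ → Ω → O} (hindep : iIndepFun o P)
    (hlaw : ∀ i, HasLaw (o i) ((model φ θ).bind S).toMeasure P)
    {θhat : ℕ → Ω → EuclideanSpace ℝ (Fin d)} (hmeas : ∀ n, AEMeasurable (θhat n) P)
    (hest : ∀ n, ∀ᵐ ω ∂P,
      IsMomentEstimate φ (empiricalMoment β n fun i => o i ω) (θhat n ω)) :
    HasAsymptoticVariance P θhat θ ((fisherInformation φ θ)⁻¹ + (fisherInformation φ θ)⁻¹ *
      channelCovariance (model φ θ) S β * (fisherInformation φ θ)⁻¹) := by
  have hX : MemLp (fun ω => β (o 0 ω)) 2 P :=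
    ((hlaw 0).map_eq ▸ MemLp.of_discrete : MemLp β 2 (P.map (o 0))).comp_of_map
      (hlaw 0).aemeasurable
  have hmean : ∫ ω, β (o 0 ω) ∂P = meanParam φ θ := by
    refine ((hlaw 0).integral_comp Measurable.of_discrete.aestronglyMeasurable).trans ?_
    rw [integral_bind]
    simp only [hβ, integral_model, meanParam]
  have hcov : covarianceMatrix (fun ω => β (o 0 ω)) P =
      fisherInformation φ θ + channelCovariance (model φ θ) S β := by
    rw [covarianceMatrix_comp_of_hasLaw (hlaw 0) .of_discrete, covarianceMatrix_bind]
    simp only [hβ]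
    rfl
  have hdecomp : (fisherInformation φ θ)⁻¹ + (fisherInformation φ θ)⁻¹ *
      channelCovariance (model φ θ) S β * (fisherInformation φ θ)⁻¹ = (fisherInformation φ θ)⁻¹ *
        covarianceMatrix (fun ω => β (o 0 ω)) P * (fisherInformation φ θ)⁻¹ := by
    rw [hcov, mul_add, nonsing_inv_mul _ ((isUnit_iff_isUnit_det _).1 hI), add_mul, one_mul]
  rw [hdecomp]
  exact hasAsymptoticVariance_of_isMomentEstimate hI hX
    (hindep.comp (fun _ => β) fun _ => .of_discrete)
    (fun i => ((hlaw i).identDistrib (hlaw 0)).comp .of_discrete) hmean hmeas hest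

section RandomizedResponse

theorem keepProb_pos (t : ℝ) : 0 < keepProb t := by
  unfold keepProb
  positivity

theorem keepProb_eq_exp_mul (t : ℝ) : keepProb t = Real.exp (t / 2) * (1 - keepProb t) := by
  unfold keepProb
  field_simp
  ring

theorem keepProb_lt_one (t : ℝ) : keepProb t < 1 := by
  unfold keepProb
  rw [div_lt_one (by positivity)]
  linarith

theorem half_lt_keepProb {t : ℝ} (ht : 0 < t) : 1 / 2 < keepProb t := by
  have hexp : 1 < Real.exp (t / 2) := Real.one_lt_exp_iff.2 (half_pos ht)
  unfold keepProb
  rw [div_lt_div_iff₀ two_pos (by positivity)]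
  linarith

theorem bern_apply {r : ℝ} (h0 : 0 ≤ r) (h1 : r ≤ 1) (b : Bool) :
    bern r b = ENNReal.ofReal (if b then r else 1 - r) := by
  cases b <;> simp [bern, h1, ENNReal.ofReal_sub _ h0]

theorem integral_bern {r : ℝ} (h0 : 0 ≤ r) (h1 : r ≤ 1) (f : Bool → ℝ) :
    ∫ b, f b ∂(bern r).toMeasure = r * f true + (1 - r) * f false := by
  simp [PMF.integral_eq_sum, bern_apply h0 h1, h0, h1]

/-- Randomized response on the bit `t`: the distribution of the bit that is `t` with probability
`q` and `!t` otherwise. -/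
noncomputable def randomizedResponse (q : ℝ) (t : Bool) : PMF Bool :=
  (bern q).map fun keep => if keep then t else !t

theorem randomizedResponse_apply {q : ℝ} (h0 : 0 ≤ q) (h1 : q ≤ 1) (t b : Bool) :
    randomizedResponse q t b = ENNReal.ofReal (if b = t then q else 1 - q) := by
  cases t <;> cases b <;> simp [randomizedResponse, PMF.map_apply, bern_apply h0 h1]

theorem integral_randomizedResponse {q : ℝ} (h0 : 0 ≤ q) (h1 : q ≤ 1) (t : Bool) (f : Bool → ℝ) :
    ∫ b, f b ∂(randomizedResponse q t).toMeasure = q * f t + (1 - q) * f (!t) := by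
  cases t <;> simp [PMF.integral_eq_sum, randomizedResponse_apply h0 h1, h0, h1, add_comm]

/-- The affine function of a bit released by `randomizedResponse q` whose mean is the original
bit. -/
noncomputable def debias (q : ℝ) (b : Bool) : ℝ :=
  ((if b then 1 else 0) - 1 + q) / (2 * q - 1)

variable {q r c x : ℝ}

theorem integral_debias (hr0 : 0 ≤ r) (hr1 : r ≤ 1) (hq0 : 0 ≤ q) (hq1 : q ≤ 1)
    (hq : q ≠ 1 / 2) :
    ∫ b, debias q b ∂((bern r).bind (randomizedResponse q)).toMeasure = r := by
  have hdenom : q * 2 - 1 ≠ 0 := by grind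
  simp only [integral_bind, integral_bern hr0 hr1, integral_randomizedResponse hq0 hq1, debias,
    Bool.not_true, Bool.not_false, if_true, Bool.false_eq_true, if_false]
  field_simp
  ring

theorem integral_debias_sq (hr0 : 0 ≤ r) (hr1 : r ≤ 1) (hq0 : 0 ≤ q) (hq1 : q ≤ 1)
    (hq : q ≠ 1 / 2) :
    ∫ b, debias q b ^ 2 ∂((bern r).bind (randomizedResponse q)).toMeasure =
      r + q * (1 - q) / (2 * q - 1) ^ 2 := by
  have hdenom : q * 2 - 1 ≠ 0 := by grind
  simp only [integral_bind, integral_bern hr0 hr1, integral_randomizedResponse hq0 hq1, debias,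
    Bool.not_true, Bool.not_false, if_true, Bool.false_eq_true, if_false]
  field_simp
  ring

theorem integral_debias_mul (hc : 0 < c) (hx : x ∈ Set.Icc 0 c) (hq0 : 0 ≤ q) (hq1 : q ≤ 1)
    (hq : q ≠ 1 / 2) :
    ∫ b, debias q b * c ∂((bern (x / c)).bind (randomizedResponse q)).toMeasure = x := by
  rw [integral_mul_const, integral_debias (div_nonneg hx.1 hc.le) ((div_le_one hc).2 hx.2) hq0 hq1
    hq, div_mul_cancel₀ _ hc.ne']

theorem integral_debias_mul_sq (hc : 0 < c) (hx : x ∈ Set.Icc 0 c) (hq0 : 0 ≤ q) (hq1 : q ≤ 1)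
    (hq : q ≠ 1 / 2) :
    ∫ b, (debias q b * c) ^ 2 ∂((bern (x / c)).bind (randomizedResponse q)).toMeasure =
      c * x + c ^ 2 * (q * (1 - q) / (2 * q - 1) ^ 2) := by
  simp only [mul_pow]
  rw [integral_mul_const, integral_debias_sq (div_nonneg hx.1 hc.le) ((div_le_one hc).2 hx.2) hq0
    hq1 hq]
  field_simp

end RandomizedResponse

section JointLaw

variable {X O : Type*}

theorem jointLaw_apply (π : PMF X) (S : X → PMF O) (x : X) (o : O) :
    jointLaw π S (x, o) = π x * S x o := by
  rw [jointLaw, PMF.bind_apply, tsum_eq_single x, PMF.map_apply, tsum_eq_single o]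
  · simp
  · simp +contextual [Prod.ext_iff, eq_comm]
  · simp +contextual [PMF.map_apply, Prod.ext_iff, eq_comm]

theorem map_snd_jointLaw (π : PMF X) (S : X → PMF O) :
    (jointLaw π S).map Prod.snd = π.bind S := by
  simp only [jointLaw, PMF.map_bind, PMF.map_comp]
  exact congrArg π.bind (funext fun x => (S x).map_id)

theorem hasLaw_of_hasLaw_prodMk_jointLaw [MeasurableSpace X] [MeasurableSpace O] {Ω : Type*}
    [MeasurableSpace Ω] {P : Measure Ω} {π : PMF X} {S : X → PMF O} {x : Ω → X} {o : Ω → O}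
    (h : HasLaw (fun ω => (x ω, o ω)) (jointLaw π S).toMeasure P) :
    HasLaw o (π.bind S).toMeasure P := by
  have hsnd : HasLaw Prod.snd (π.bind S).toMeasure (jointLaw π S).toMeasure :=
    ⟨measurable_snd.aemeasurable, by rw [PMF.toMeasure_map _ _ measurable_snd, map_snd_jointLaw]⟩
  exact hsnd.comp h

theorem integral_jointLaw [Fintype X] [MeasurableSpace X] [DiscreteMeasurableSpace X] [Finite O]
    [MeasurableSpace O] [DiscreteMeasurableSpace O] (π : PMF X) (S : X → PMF O) (f : X × O → ℝ) :
    ∫ z, f z ∂(jointLaw π S).toMeasure =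
      ∑ x, (π x).toReal * ∫ o, f (x, o) ∂(S x).toMeasure := by
  have := Fintype.ofFinite O
  simp only [PMF.integral_eq_sum, Fintype.sum_prod_type, jointLaw_apply, ENNReal.toReal_mul,
    smul_eq_mul, Finset.mul_sum, mul_assoc]

end JointLaw

section Privacy

variable {X Y O : Type*} {α α' : ℝ}

theorem IsDifferentiallyPrivate.mono {S : Y → PMF O} (hS : IsDifferentiallyPrivate S α)
    (h : α ≤ α') : IsDifferentiallyPrivate S α' := fun o y y' =>
  (hS o y y').trans (by gcongr)

theorem IsDifferentiallyPrivate.bind_left {T : X → PMF O} (hT : IsDifferentiallyPrivate T α)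
    (K : Y → PMF X) : IsDifferentiallyPrivate (fun y => (K y).bind T) α := by
  intro o y y'
  have hle (x : X) : T x o ≤ ENNReal.ofReal (Real.exp α) * (K y').bind T o := by
    rw [PMF.bind_apply, ← ENNReal.tsum_mul_left]
    calc T x o = ∑' x', K y' x' * T x o := by rw [ENNReal.tsum_mul_right, PMF.tsum_coe, one_mul]
      _ ≤ ∑' x', ENNReal.ofReal (Real.exp α) * (K y' x' * T x' o) :=
        ENNReal.tsum_le_tsum fun x' => by
          rw [mul_left_comm]
          gcongr
          exact hT o x x'
  calc (K y).bind T o = ∑' x, K y x * T x o := PMF.bind_apply _ _ _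
    _ ≤ ∑' x, K y x * (ENNReal.ofReal (Real.exp α) * (K y').bind T o) := by
      gcongr with x
      exact hle x
    _ = ENNReal.ofReal (Real.exp α) * (K y').bind T o := by
      rw [ENNReal.tsum_mul_right, PMF.tsum_coe, one_mul]

theorem isDifferentiallyPrivate_jointLaw (π : PMF X) {S : X → Y → PMF O}
    (hS : ∀ x, IsDifferentiallyPrivate (S x) α) :
    IsDifferentiallyPrivate (fun y => jointLaw π fun x => S x y) α := by
  rintro ⟨x, o⟩ y y'
  simp only [jointLaw_apply]
  rw [mul_left_comm]
  gcongr
  exact hS x o y y'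

theorem isDifferentiallyPrivate_randomizedResponse (hα : 0 ≤ α) :
    IsDifferentiallyPrivate (randomizedResponse (keepProb α)) (α / 2) := by
  have hexp : 1 ≤ Real.exp (α / 2) := Real.one_le_exp (by positivity)
  have hq := keepProb_eq_exp_mul α
  have hq0 := keepProb_pos α
  have hq1 := keepProb_lt_one α
  intro b t t'
  rw [randomizedResponse_apply hq0.le hq1.le, randomizedResponse_apply hq0.le hq1.le,
    ← ENNReal.ofReal_mul (Real.exp_pos _).le]
  refine ENNReal.ofReal_le_ofReal ?_
  split_ifs <;> nlinarith

end Privacy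

section InverseProbabilityWeighting

variable {ι X : Type*} [DecidableEq ι]

/-- The inverse-probability-weighted estimate, from a single observation `x = (j, b)` with
`j ∼ p`, of the vector of means of the functions `f i`: coordinate `j` is `f j b / p j`, the other
coordinates vanish. -/
noncomputable def inverseProbabilityEstimate (p : PMF ι) (f : ι → X → ℝ) (x : ι × X) :
    EuclideanSpace ℝ ι :=
  ((p x.1).toReal⁻¹ * f x.1 x.2) • EuclideanSpace.single x.1 (1 : ℝ)

variable [Finite ι] [MeasurableSpace ι] [DiscreteMeasurableSpace ι] [Finite X]
  [MeasurableSpace X] [DiscreteMeasurableSpace X] {p : PMF ι}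

theorem integral_inverseProbabilityEstimate (hp : ∀ i, p i ≠ 0) (R : ι → PMF X) (f : ι → X → ℝ)
    (i : ι) :
    ∫ x, inverseProbabilityEstimate p f x i ∂(jointLaw p R).toMeasure =
      ∫ b, f i b ∂(R i).toMeasure := by
  have := Fintype.ofFinite ι
  have hpi : (p i).toReal ≠ 0 := ENNReal.toReal_ne_zero.2 ⟨hp i, p.apply_ne_top i⟩
  rw [integral_jointLaw, Finset.sum_eq_single i _ (by simp)]
  · simp [inverseProbabilityEstimate, integral_const_mul, hpi]
  · intro j _ hj
    simp [inverseProbabilityEstimate, hj.symm]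

theorem covarianceMatrix_inverseProbabilityEstimate (hp : ∀ i, p i ≠ 0) (R : ι → PMF X)
    (f : ι → X → ℝ) :
    covarianceMatrix (inverseProbabilityEstimate p f) (jointLaw p R).toMeasure =
      diagonal (fun i => (p i).toReal⁻¹ * ∫ b, f i b ^ 2 ∂(R i).toMeasure) -
        vecMulVec (fun i => ∫ b, f i b ∂(R i).toMeasure)
          (fun i => ∫ b, f i b ∂(R i).toMeasure) := by
  have := Fintype.ofFinite ι
  ext i j
  have hpi : (p i).toReal ≠ 0 := ENNReal.toReal_ne_zero.2 ⟨hp i, p.apply_ne_top i⟩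
  have hprod : ∫ x, inverseProbabilityEstimate p f x i * inverseProbabilityEstimate p f x j
      ∂(jointLaw p R).toMeasure =
        diagonal (fun i => (p i).toReal⁻¹ * ∫ b, f i b ^ 2 ∂(R i).toMeasure) i j := by
    rw [integral_jointLaw, Finset.sum_eq_single i _ (by simp)]
    · rcases eq_or_ne i j with rfl | hij
      · simp only [inverseProbabilityEstimate, PiLp.smul_apply, PiLp.single_apply,
          if_true, smul_eq_mul, mul_one, diagonal_apply_eq, mul_mul_mul_comm _ (f i _), ← sq,
          integral_const_mul]
        field_simp
      · simp [inverseProbabilityEstimate, hij, hij.symm]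
    · intro k _ hk
      simp [inverseProbabilityEstimate, hk.symm]
  rw [Matrix.sub_apply, vecMulVec_apply, ← hprod, covarianceMatrix, of_apply,
    covariance_eq_sub .of_discrete .of_discrete, integral_inverseProbabilityEstimate hp,
    integral_inverseProbabilityEstimate hp]
  rfl

end InverseProbabilityWeighting

section CoordinateRelease

variable {d : ℕ}

theorem map_eval_binarize (c : ℝ) (v : EuclideanSpace ℝ (Fin d)) (j : Fin d) :
    (binarize c v).map (fun t => t j) = bern (v j / c) := by
  ext b
  have hcylinder : ({t | b = t j} : Finset (Fin d → Bool)) =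
      Fintype.piFinset fun i => if i = j then ({b} : Finset Bool) else Finset.univ := by
    ext t
    simp only [Finset.mem_filter, Finset.mem_univ, true_and, Fintype.mem_piFinset]
    refine ⟨fun h i => ?_, fun h => ?_⟩
    · split_ifs with hij
      · simp [hij, h]
      · simp
    · simpa [eq_comm] using h j
  have hsum (i : Fin d) : ∑ a, bern (v i / c) a = 1 := by
    rw [← tsum_fintype (L := .unconditional _), PMF.tsum_coe]
  calc (binarize c v).map (fun t => t j) b =
        ∑ t : Fin d → Bool with b = t j, ∏ i, bern (v i / c) (t i) := by
        rw [PMF.map_apply, tsum_fintype, Finset.sum_filter]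
        congr!
    _ = ∏ i, ∑ a ∈ if i = j then {b} else Finset.univ, bern (v i / c) a := by
        rw [hcylinder, Finset.prod_univ_sum]
    _ = bern (v j / c) b := by
        rw [Finset.prod_eq_single j _ (by simp)]
        · simp
        · intro i _ hij
          rw [if_neg hij, hsum]

theorem coordinateRelease_eq_jointLaw (p : PMF (Fin d)) (α c : ℝ) (v : EuclideanSpace ℝ (Fin d)) :
    coordinateRelease p α c v =
      jointLaw p fun j => (bern (v j / c)).bind (randomizedResponse (keepProb α)) := by
  simp only [← map_eval_binarize, jointLaw, PMF.bind_map, PMF.map_bind]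
  rw [coordinateRelease, PMF.bind_comm]
  simp only [randomizedResponse, PMF.map_comp, Function.comp_def]

theorem isDifferentiallyPrivate_coordinateRelease {Y : Type*} {α : ℝ} (hα : 0 ≤ α)
    (p : PMF (Fin d)) (c : ℝ) (φ : Y → EuclideanSpace ℝ (Fin d)) :
    IsDifferentiallyPrivate (fun y => coordinateRelease p α c (φ y)) (α / 2) := by
  simp only [coordinateRelease_eq_jointLaw]
  exact isDifferentiallyPrivate_jointLaw p fun j =>
    (isDifferentiallyPrivate_randomizedResponse hα).bind_left fun y => bern (φ y j / c)

theorem coordinateReleaseObs_eq_inverseProbabilityEstimate (p : PMF (Fin d)) (α c : ℝ) :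
    coordinateReleaseObs p α c =
      inverseProbabilityEstimate p fun _ b => debias (keepProb α) b * c := by
  ext1 o
  rw [coordinateReleaseObs, inverseProbabilityEstimate, debias, mul_assoc]

/-- The covariance matrix of the observation `β(j, b)` of the coordinate release of a vector `v`
with coordinates in `[0, c]`. -/
noncomputable def coordinateReleaseCovariance (p : PMF (Fin d)) (α c : ℝ)
    (v : EuclideanSpace ℝ (Fin d)) : Matrix (Fin d) (Fin d) ℝ :=
  diagonal (fun i => (p i).toReal⁻¹ *
    (c * v i + c ^ 2 * (keepProb α * (1 - keepProb α) / (2 * keepProb α - 1) ^ 2))) -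
      vecMulVec v v

variable {p : PMF (Fin d)} {α c : ℝ} {v : EuclideanSpace ℝ (Fin d)}

theorem integral_coordinateReleaseObs (hp : ∀ i, p i ≠ 0) (hα : 0 < α) (hc : 0 < c)
    (hv : ∀ i, v i ∈ Set.Icc 0 c) :
    ∫ o, coordinateReleaseObs p α c o ∂(coordinateRelease p α c v).toMeasure = v := by
  ext i
  rw [eval_integral_piLp fun _ => .of_finite, coordinateReleaseObs_eq_inverseProbabilityEstimate,
    coordinateRelease_eq_jointLaw, integral_inverseProbabilityEstimate hp,
    integral_debias_mul hc (hv i) (keepProb_pos α).le (keepProb_lt_one α).le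
      (half_lt_keepProb hα).ne']

theorem covarianceMatrix_coordinateReleaseObs (hp : ∀ i, p i ≠ 0) (hα : 0 < α) (hc : 0 < c)
    (hv : ∀ i, v i ∈ Set.Icc 0 c) :
    covarianceMatrix (coordinateReleaseObs p α c) (coordinateRelease p α c v).toMeasure =
      coordinateReleaseCovariance p α c v := by
  rw [coordinateReleaseObs_eq_inverseProbabilityEstimate, coordinateRelease_eq_jointLaw,
    covarianceMatrix_inverseProbabilityEstimate hp]
  have hq := (half_lt_keepProb hα).ne'
  simp only [coordinateReleaseCovariance,
    integral_debias_mul hc (hv _) (keepProb_pos α).le (keepProb_lt_one α).le hq,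
    integral_debias_mul_sq hc (hv _) (keepProb_pos α).le (keepProb_lt_one α).le hq]

theorem integral_coordinateReleaseCovariance_uniformOfFintype [NeZero d] {Y : Type*} [Finite Y]
    [MeasurableSpace Y] [DiscreteMeasurableSpace Y] {φ : Y → EuclideanSpace ℝ (Fin d)}
    (hφ : ∀ y i, φ y i = 0 ∨ φ y i = 1) (π : PMF Y) (α : ℝ) :
    (of fun i j => ∫ y, coordinateReleaseCovariance (PMF.uniformOfFintype (Fin d)) α 1 (φ y) i j
      ∂π.toMeasure) = coordinateReleaseLoss φ π α := by
  have hcov (y : Y) : coordinateReleaseCovariance (PMF.uniformOfFintype (Fin d)) α 1 (φ y) =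
      ((d : ℝ) * keepProb α * (1 - keepProb α) / (2 * keepProb α - 1) ^ 2) • 1 +
        ((d : ℝ) • (diagonal fun k => φ y k) ^ 2 - vecMulVec (φ y) (φ y)) := by
    have hsq (i : Fin d) : φ y i ^ 2 = φ y i := by rcases hφ y i with h | h <;> simp [h]
    ext i j
    rcases eq_or_ne i j with rfl | hij
    · simp [coordinateReleaseCovariance, diagonal_pow, hsq]
      ring
    · simp [coordinateReleaseCovariance, diagonal_pow, hij]
  ext i j
  simp only [hcov, coordinateReleaseLoss, of_apply, Matrix.add_apply]
  rw [integral_add .of_finite .of_finite, integral_const, probReal_univ, one_smul]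

end CoordinateRelease

end IndirectSupervision

open IndirectSupervision in
theorem mainTheorem4_general {Y : Type*} [Fintype Y] [Nonempty Y] [MeasurableSpace Y]
    [DiscreteMeasurableSpace Y] {d : ℕ} {c : ℝ} (hc : 0 < c) {φ : Y → EuclideanSpace ℝ (Fin d)}
    (hφ : ∀ y i, φ y i ∈ Set.Icc 0 c) {p : PMF (Fin d)} (hp : ∀ i, p i ≠ 0) {α : ℝ} (hα : 0 < α)
    {θstar : EuclideanSpace ℝ (Fin d)} (hI : IsUnit (fisherInformation φ θstar)) :
    IsDifferentiallyPrivate (fun y => coordinateRelease p α c (φ y)) (α / 2) ∧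
    ∀ {Ω : Type*} [MeasurableSpace Ω] (P : Measure Ω) [IsProbabilityMeasure P]
      (o : ℕ → Ω → Fin d × Bool) (_hindep : iIndepFun o P)
      (_hlaw : ∀ i, HasLaw (o i)
        ((model φ θstar).bind fun y => coordinateRelease p α c (φ y)).toMeasure P)
      (θhat : ℕ → Ω → EuclideanSpace ℝ (Fin d)) (_hmeas : ∀ n, AEMeasurable (θhat n) P)
      (_hest : ∀ n, ∀ᵐ ω ∂P, IsMomentEstimate φ
        (empiricalMoment (coordinateReleaseObs p α c) n fun i => o i ω) (θhat n ω)),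
      HasAsymptoticVariance P θhat θstar ((fisherInformation φ θstar)⁻¹ +
        (fisherInformation φ θstar)⁻¹ *
          (of fun i j => ∫ y, coordinateReleaseCovariance p α c (φ y) i j
            ∂(model φ θstar).toMeasure) *
          (fisherInformation φ θstar)⁻¹) := by
  refine ⟨isDifferentiallyPrivate_coordinateRelease hα.le p c φ, ?_⟩
  intro Ω _ P _ o hindep hlaw θhat hmeas hest
  simp only [← covarianceMatrix_coordinateReleaseObs hp hα hc (hφ _)]
  exact hasAsymptoticVariance_of_unbiased hI
    (fun y => integral_coordinateReleaseObs hp hα hc (hφ y)) hindep hlaw hmeas hest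

theorem mainTheorem4 {Y : Type*} [Fintype Y] [Nonempty Y] [MeasurableSpace Y]
    [DiscreteMeasurableSpace Y] {d : ℕ} [NeZero d]
    (φ : Y → EuclideanSpace ℝ (Fin d)) (hφ : ∀ y i, φ y i = 0 ∨ φ y i = 1)
    (α : ℝ) (hα : 0 < α)
    (θstar : EuclideanSpace ℝ (Fin d))
    (hI : IsUnit (IndirectSupervision.fisherInformation φ θstar)) :
    IndirectSupervision.IsDifferentiallyPrivate
      (fun y => IndirectSupervision.coordinateRelease (PMF.uniformOfFintype (Fin d)) α 1 (φ y)) α ∧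
    ∀ {Ω : Type*} [MeasurableSpace Ω] (P : Measure Ω) [IsProbabilityMeasure P]
      (y : ℕ → Ω → Y) (o : ℕ → Ω → Fin d × Bool)
      (_hindep : iIndepFun (fun i ω => (y i ω, o i ω)) P)
      (_hlaw : ∀ i, HasLaw (fun ω => (y i ω, o i ω))
        (IndirectSupervision.jointLaw (IndirectSupervision.model φ θstar) fun y' =>
          IndirectSupervision.coordinateRelease
            (PMF.uniformOfFintype (Fin d)) α 1 (φ y')).toMeasure P)
      (θhat : ℕ → Ω → EuclideanSpace ℝ (Fin d))
      (_hmeas : ∀ n, AEMeasurable (θhat n) P)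
      (_hest : ∀ n, ∀ᵐ ω ∂P, IndirectSupervision.IsMomentEstimate φ
        (IndirectSupervision.empiricalMoment
          (IndirectSupervision.coordinateReleaseObs (PMF.uniformOfFintype (Fin d)) α 1) n
          (fun i => o i ω))
        (θhat n ω)),
      IndirectSupervision.HasAsymptoticVariance P θhat θstar
        ((IndirectSupervision.fisherInformation φ θstar)⁻¹ +
          (IndirectSupervision.fisherInformation φ θstar)⁻¹ *
            IndirectSupervision.coordinateReleaseLoss φ
              (IndirectSupervision.model φ θstar) α *
            (IndirectSupervision.fisherInformation φ θstar)⁻¹) := by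
  have hφ' (y : Y) (i : Fin d) : φ y i ∈ Set.Icc 0 1 := by rcases hφ y i with h | h <;> simp [h]
  have hp (i : Fin d) : PMF.uniformOfFintype (Fin d) i ≠ 0 := by simp
  have hgeneral := mainTheorem4_general one_pos hφ' hp hα hI
  refine ⟨hgeneral.1.mono (half_le_self hα.le), fun P _ y o hindep hlaw θhat hmeas hest => ?_⟩
  rw [← IndirectSupervision.integral_coordinateReleaseCovariance_uniformOfFintype hφ]
  exact hgeneral.2 P o (hindep.comp (fun _ => Prod.snd) fun _ => measurable_snd)
    (fun i => IndirectSupervision.hasLaw_of_hasLaw_prodMk_jointLaw (hlaw i)) θhat hmeas hest
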